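/- Let $\mathbb{O}$ be the algebra of octonions with standard basis $e_0=1,e_1,\dots,e_7$, where $e_ie_j=-\delta_{ij}+\sum_k\epsilon_{ijk}e_k$ for $i,j\ge1$ and $\epsilon$ is totally antisymmetric, equal to $1$ on the triples $(1,2,3),(1,4,5),(2,4,6),(3,4,7),(5,3,6),(6,1,7),(7,2,5)$ and $0$ off their permutations. Identify $\mathbb{O}$ with $\mathbb{R}^8$, and let $|\cdot|$ be the Euclidean norm. Fix $p\in\{0,1,\dots,6\}$, identify $\mathbb{R}^{p+1}$ with $\mathrm{span}_{\mathbb R}(e_0,\dots,e_p)$, and let $\mathbb{S}$ be the unit sphere of $\mathrm{span}_{\mathbb R}(e_{p+1},\dots,e_7)$. For $\Omega\subseteq\mathbb{O}$ and $\omega\in\mathbb{S}$ let $\Omega_\omega=\Omega\cap(\mathbb{R}^{p+1}\oplus\omega\mathbb{R})$, regarded as a subset of $\mathbb{R}^{p+2}$ through the coordinates $(x_0,\dots,x_p,r)\mapsto x_0e_0+\dots+x_pe_p+r\omega$. A domain is a nonempty connected open set. A domain $\Omega\subseteq\mathbb{O}$ is a slice domain if $\Omega\cap\mathbb{R}^{p+1}\neq\emptyset$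 and $\Omega_\omega$ is a domain in $\mathbb{R}^{p+2}$ for every $\omega\in\mathbb{S}$. A function $f:\Omega\to\mathbb{O}$ is (left) generalized partial-slice monogenic (of type $p$) if for every $\omega\in\mathbb{S}$ its restriction $f_\omega$ to $\Omega_\omega$ is of class $C^1$ and satisfies $$\sum_{i=0}^{p}e_i\,\frac{\partial f_\omega}{\partial x_i}+\omega\,\frac{\partial f_\omega}{\partial r}=0\quad\text{on }\Omega_\omega .$$ **Theorem (Maximum modulus principle).** Let $\Omega\subseteq\mathbb{O}$ be a slice domain and let $f:\Omega\to\mathbb{O}$ be a generalized partial-slice monogenic function. If $|f|$ has a relative maximum at some point of $\Omega$, then $f$ is constant on $\Omega$. -/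

import Mathlib

/-- The underlying real Euclidean space `ℝ⁸` of the octonions. The element
`(x₀, …, x₇)` stands for `x₀ + x₁ e₁ + ⋯ + x₇ e₇`; the modulus `|x|` is the Euclidean norm. -/
abbrev Octonion : Type := EuclideanSpace ℝ (Fin 8)

namespace Octonion

/-- The seven oriented triples `(a, b, c)` with `e_a e_b = e_c`. -/
def triples : List (Fin 8 × Fin 8 × Fin 8) :=
  [(1, 2, 3), (1, 4, 5), (2, 4, 6), (3, 4, 7), (5, 3, 6), (6, 1, 7), (7, 2, 5)]

/-- `ε_{ijk}`: the sign of the permutation if `(i, j, k)` is a permutation of one of the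
seven triples, and `0` otherwise. -/
def eps (i j k : Fin 8) : ℤ :=
  if (i, j, k) ∈ triples ∨ (j, k, i) ∈ triples ∨ (k, i, j) ∈ triples then 1
  else if (j, i, k) ∈ triples ∨ (i, k, j) ∈ triples ∨ (k, j, i) ∈ triples then -1
  else 0

/-- The coefficient of `e_k` in the product `e_i e_j`, where `e_0 = 1` is the unit and
`e_i e_j = -δ_{ij} + ∑ k, ε_{ijk} e_k` for `i, j ≥ 1`. -/
def structureConst (i j k : Fin 8) : ℤ :=
  if i = 0 then (if j = k then 1 else 0)
  else if j = 0 then (if i = k then 1 else 0)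
  else (if i = j ∧ k = 0 then -1 else 0) + eps i j k

/-- Octonionic multiplication: the bilinear extension of the multiplication of the basis. -/
noncomputable instance instMul : Mul Octonion where
  mul x y := WithLp.toLp 2 fun k =>
    ∑ i : Fin 8, ∑ j : Fin 8, (structureConst i j k : ℝ) * (x i * y j)

/-- The standard basis vector `e_i` of the octonions. -/
noncomputable def e (i : Fin 8) : Octonion := EuclideanSpace.single i 1

/-- The subspace `ℝ^{p+1}` of the octonions spanned by `e_0, …, e_p`. -/
def paravectors (p : Fin 7) : Set Octonion :=
  {x | ∀ i : Fin 8, (p : ℕ) < (i : ℕ) → x i = 0}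

/-- The unit sphere `𝕊` of the subspace spanned by `e_{p+1}, …, e_7`. -/
def sphere (p : Fin 7) : Set Octonion :=
  {ω | (∀ i : Fin 8, (i : ℕ) ≤ (p : ℕ) → ω i = 0) ∧ ‖ω‖ = 1}

/-- An index `i ∈ {0, …, p}`, seen as an index of a basis vector of the octonions. -/
def idx (p : Fin 7) (i : Fin ((p : ℕ) + 1)) : Fin 8 :=
  Fin.castLE (by omega) i

/-- The identification of `ℝ^{p+2}` with the slice `ℝ^{p+1} ⊕ ω ℝ`:
`(x₀, …, x_p, r) ↦ x₀ e_0 + ⋯ + x_p e_p + r ω`. -/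
noncomputable def slicePoint (p : Fin 7) (ω : Octonion)
    (v : EuclideanSpace ℝ (Fin ((p : ℕ) + 2))) : Octonion :=
  (∑ i : Fin ((p : ℕ) + 1), v i.castSucc • e (idx p i)) + v (Fin.last ((p : ℕ) + 1)) • ω

/-- The slice `Ω_ω = Ω ∩ (ℝ^{p+1} ⊕ ω ℝ)`, as a subset of `ℝ^{p+2}`. -/
def slice (p : Fin 7) (ω : Octonion) (Ω : Set Octonion) :
    Set (EuclideanSpace ℝ (Fin ((p : ℕ) + 2))) :=
  {v | slicePoint p ω v ∈ Ω}

/-- The restriction `f_ω` of `f` to a slice, as a function of `(x₀, …, x_p, r) ∈ ℝ^{p+2}`. -/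
noncomputable def restrict (p : Fin 7) (ω : Octonion) (f : Octonion → Octonion) :
    EuclideanSpace ℝ (Fin ((p : ℕ) + 2)) → Octonion :=
  fun v => f (slicePoint p ω v)

/-- The left slice Cauchy-Riemann operator
`D_ω F = ∑ i = 0, …, p, e_i (∂F/∂x_i) + ω (∂F/∂r)` for functions `F` on `ℝ^{p+2}`. -/
noncomputable def sliceD (p : Fin 7) (ω : Octonion)
    (F : EuclideanSpace ℝ (Fin ((p : ℕ) + 2)) → Octonion)
    (v : EuclideanSpace ℝ (Fin ((p : ℕ) + 2))) : Octonion :=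
  (∑ i : Fin ((p : ℕ) + 1),
      e (idx p i) * fderiv ℝ F v (EuclideanSpace.single i.castSucc 1)) +
    ω * fderiv ℝ F v (EuclideanSpace.single (Fin.last ((p : ℕ) + 1)) 1)

/-- `f` is (left) generalized partial-slice monogenic of type `p` on the open set `Ω`; only the
values of `f` on `Ω` matter. -/
def IsGSM (p : Fin 7) (Ω : Set Octonion) (f : Octonion → Octonion) : Prop :=
  ∀ ω ∈ sphere p,
    ContDiffOn ℝ 1 (restrict p ω f) (slice p ω Ω) ∧
      ∀ v ∈ slice p ω Ω, sliceD p ω (restrict p ω f) v = 0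

/-- `Ω` is a slice domain: a domain (nonempty connected open set) of the octonions that meets
`ℝ^{p+1}` and all of whose slices `Ω_ω` are domains in `ℝ^{p+2}`. -/
structure IsSliceDomain (p : Fin 7) (Ω : Set Octonion) : Prop where
  isOpen : IsOpen Ω
  isConnected : IsConnected Ω
  inter_nonempty : (Ω ∩ paravectors p).Nonempty
  slice_isOpen : ∀ ω ∈ sphere p, IsOpen (slice p ω Ω)
  slice_isConnected : ∀ ω ∈ sphere p, IsConnected (slice p ω Ω)

end Octonion

/-! ### Dirac-type operators under Clifford relations, and weak harmonicity. -/

section Dirac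

open MeasureTheory Metric Set Filter Topology
open scoped ContDiff

variable {ι : Type*} [Fintype ι] [DecidableEq ι]
  {V : Type*} [NormedAddCommGroup V] [InnerProductSpace ℝ V] [CompleteSpace V]

/-! On the slice of `ω` the equation reads `∑ᵢ Lᵢ ∂ᵢF = 0`, where `Lᵢ` is left multiplication by the
members of the orthonormal system `e_0, …, e_p, ω`. Although octonions are not associative,
alternativity gives `ā(bx) + b̄(ax) = 2⟨a,b⟩x` (`octConj_mul_mul_add`), and these Clifford relations
are all that the analysis uses. It is therefore carried out for abstract operators `Lᵢ`.

The relations make a `C¹` solution weakly harmonic. Testing against a potential whose gradient is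
radial gives a weighted mean value property (`integral_radialKernel_smul_of_contDiff`), and from it
follow smoothness, interior derivative estimates, unique continuation from a zero of infinite order
(`eq_zero_of_isPreconnected`) and local constancy near a maximum of the modulus
(`eventually_eq_of_isLocalMax_norm`).

If `|f|` has a local maximum at `a`, then `f` equals a constant `c` on a slice through `a`, hence on
`Ω ∩ ℝ^{p+1}`, which lies in every slice as the hyperplane `r = 0`. On another slice `f - c`
vanishes on that hyperplane, so its tangential derivatives vanish there and the equation kills the
normal one. Derivatives are again monogenic, so by iteration all of them vanish, and unique
continuation gives `f = c` on that slice. The slices cover `Ω`. -/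

/-- The Clifford relations `L'ᵢ Lⱼ + L'ⱼ Lᵢ = 2 δᵢⱼ`. -/
def IsCliffordPair (L L' : ι → V →L[ℝ] V) : Prop :=
  ∀ i j x, L' i (L j x) + L' j (L i x) = if i = j then (2 : ℝ) • x else 0

/-- The Dirac operator `∑ᵢ Lᵢ ∂ᵢ`. -/
noncomputable def dirac (L : ι → V →L[ℝ] V) (F : EuclideanSpace ℝ ι → V)
    (x : EuclideanSpace ℝ ι) : V :=
  ∑ i, L i (fderiv ℝ F x (EuclideanSpace.single i 1))

/-- `C¹` solutions of `∑ᵢ Lᵢ ∂ᵢF = 0`. -/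
structure IsMonogenicOn (L : ι → V →L[ℝ] V) (F : EuclideanSpace ℝ ι → V)
    (U : Set (EuclideanSpace ℝ ι)) : Prop where
  contDiffOn : ContDiffOn ℝ 1 F U
  dirac_eq_zero : ∀ x ∈ U, dirac L F x = 0

omit [DecidableEq ι] [CompleteSpace V] in
lemma integrable_smul_of_hasCompactSupport {χ : EuclideanSpace ℝ ι → ℝ}
    {F : EuclideanSpace ℝ ι → V} (hχ : Continuous χ) (hc : HasCompactSupport χ)
    (hF : Continuous F) : Integrable (fun y => χ y • F y) :=
  (hχ.smul hF).integrable_of_hasCompactSupport hc.smul_right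

-- `F` is only `C¹`, so the derivative on `F` is moved onto `χ`, whose second derivative is
-- symmetric.
omit [DecidableEq ι] [CompleteSpace V] in
lemma integral_fderiv_smul_fderiv_comm {χ : EuclideanSpace ℝ ι → ℝ}
    {F : EuclideanSpace ℝ ι → V} (hχ : ContDiff ℝ 2 χ) (hc : HasCompactSupport χ)
    (hF : ContDiff ℝ 1 F) (u v : EuclideanSpace ℝ ι) :
    ∫ y, fderiv ℝ χ y u • fderiv ℝ F y v = ∫ y, fderiv ℝ χ y v • fderiv ℝ F y u := by
  have h1 (u) : ContDiff ℝ 1 (fun y => fderiv ℝ χ y u) :=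
    (hχ.fderiv_right (m := 1) (by norm_num)).clm_apply contDiff_const
  have h2 (u) : HasCompactSupport (fun y => fderiv ℝ χ y u) :=
    hc.fderiv_apply ℝ u
  have key (u v) : ∫ y, fderiv ℝ χ y u • fderiv ℝ F y v
      = - ∫ y, fderiv ℝ (fderiv ℝ χ) y v u • F y := by
    have e (y) : fderiv ℝ (fun z => fderiv ℝ χ z u) y v = fderiv ℝ (fderiv ℝ χ) y v u := by
      have : DifferentiableAt ℝ (fderiv ℝ χ) y :=
        ((hχ.fderiv_right (m := 1) (by norm_num)).differentiable (by norm_num)) y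
      rw [fderiv_clm_apply this (by fun_prop)]
      simp
    simp_rw [← e]
    apply integral_smul_fderiv_eq_neg_fderiv_smul_of_integrable
    · exact integrable_smul_of_hasCompactSupport
        (((h1 u).continuous_fderiv (by norm_num)).clm_apply continuous_const)
        ((h2 u).fderiv_apply ℝ v) hF.continuous
    · exact integrable_smul_of_hasCompactSupport (h1 u).continuous (h2 u)
        ((hF.continuous_fderiv (by norm_num)).clm_apply continuous_const)
    · exact integrable_smul_of_hasCompactSupport (h1 u).continuous (h2 u) hF.continuous
    · exact fun x _ => ((h1 u).differentiable (by norm_num)) x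
    · exact fun x _ => (hF.differentiable (by norm_num)) x
  rw [key, key]
  congr 1
  refine integral_congr_ae (Eventually.of_forall fun y => ?_)
  have := (hχ.contDiffAt (x := y)).isSymmSndFDerivAt (by simp)
  simp only [this u v]

/-- Weak harmonicity of `C¹` monogenic functions. -/
lemma sum_integral_fderiv_smul_fderiv_eq_zero {L L' : ι → V →L[ℝ] V} (hL : IsCliffordPair L L')
    {χ : EuclideanSpace ℝ ι → ℝ}
    {F : EuclideanSpace ℝ ι → V} (hχ : ContDiff ℝ 2 χ) (hc : HasCompactSupport χ)
    (hF : ContDiff ℝ 1 F) (hD : ∀ y ∈ tsupport χ, dirac L F y = 0) :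
    ∑ j, ∫ y, fderiv ℝ χ y (EuclideanSpace.single j 1) •
      fderiv ℝ F y (EuclideanSpace.single j 1) = 0 := by
  set A : ι → ι → V := fun i j => ∫ y, fderiv ℝ χ y (EuclideanSpace.single i 1) •
      fderiv ℝ F y (EuclideanSpace.single j 1) with hA
  have hint (i j : ι) : Integrable (fun y => fderiv ℝ χ y (EuclideanSpace.single i 1) •
      fderiv ℝ F y (EuclideanSpace.single j 1)) :=
    integrable_smul_of_hasCompactSupport
      ((hχ.continuous_fderiv (by norm_num)).clm_apply continuous_const)
      (hc.fderiv_apply ℝ _) ((hF.continuous_fderiv (by norm_num)).clm_apply continuous_const)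
  have hsymm (i j : ι) : A i j = A j i := integral_fderiv_smul_fderiv_comm hχ hc hF _ _
  -- Row `i` integrates `∂ᵢχ` against the Dirac operator of `F`, which vanishes wherever `∂ᵢχ` does
  -- not.
  have h0 (i : ι) : ∑ j, L j (A i j) = 0 := by
    have : ∀ j, L j (A i j) = ∫ y, fderiv ℝ χ y (EuclideanSpace.single i 1) •
        L j (fderiv ℝ F y (EuclideanSpace.single j 1)) := by
      intro j
      rw [hA, ← ContinuousLinearMap.integral_comp_comm _ (hint i j)]
      simp
    simp_rw [this]
    rw [← integral_finsetSum]
    · rw [← integral_zero (EuclideanSpace ℝ ι) V]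
      congr 1
      ext1 y
      rw [← Finset.smul_sum]
      by_cases hy : y ∈ tsupport χ
      · have := hD y hy
        rw [dirac] at this
        rw [this, smul_zero]
      · have : fderiv ℝ χ y = 0 := by
          by_contra h
          exact hy (support_fderiv_subset ℝ (f := χ) h)
        simp [this]
    · intro j _
      simpa using (L j).integrable_comp (hint i j)
  have h1 : ∑ i, ∑ j, L' i (L j (A i j)) = 0 := by
    simp_rw [← map_sum, h0]; simp
  have h2 : ∑ i, ∑ j, L' j (L i (A i j)) = 0 := by
    rw [Finset.sum_comm]
    exact (Finset.sum_congr rfl fun i _ => Finset.sum_congr rfl fun j _ => by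
      rw [hsymm]).trans h1
  -- Symmetry of `A` allows both orders of the indices, so the Clifford relations leave only twice
  -- the trace of `A`.
  have h3 : ∑ i, ∑ j, (L' i (L j (A i j)) + L' j (L i (A i j))) = 0 := by
    simp_rw [Finset.sum_add_distrib, h1, h2, add_zero]
  simp_rw [hL _ _ _] at h3
  simp only [Finset.sum_ite_eq, Finset.mem_univ, if_true, ← Finset.smul_sum] at h3
  simpa using h3

end Dirac

/-! ### A radial weight and a potential for its radial vector field. -/

section Kernel

open MeasureTheory Metric Set Filter Topology
open scoped ContDiff

/-- A primitive of `s ↦ -smoothTransition (1 - s)` vanishing on `[1, ∞)`. -/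
noncomputable def kernelPrimitive (s : ℝ) : ℝ :=
  -∫ t in (1 : ℝ)..s, Real.smoothTransition (1 - t)

lemma hasDerivAt_kernelPrimitive (s : ℝ) :
    HasDerivAt kernelPrimitive (-Real.smoothTransition (1 - s)) s := by
  have hc : Continuous fun t : ℝ => Real.smoothTransition (1 - t) :=
    Real.smoothTransition.continuous.comp (by fun_prop)
  exact (intervalIntegral.integral_hasDerivAt_right (hc.intervalIntegrable _ _)
    hc.aestronglyMeasurable.stronglyMeasurableAtFilter hc.continuousAt).neg

lemma contDiff_kernelPrimitive : ContDiff ℝ 2 kernelPrimitive := by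
  have hd : deriv kernelPrimitive = fun s => -Real.smoothTransition (1 - s) :=
    funext fun s => (hasDerivAt_kernelPrimitive s).deriv
  rw [show (2 : ℕ∞ω) = 1 + 1 by norm_num, contDiff_succ_iff_deriv]
  refine ⟨fun s => (hasDerivAt_kernelPrimitive s).differentiableAt, by simp, ?_⟩
  rw [hd]
  exact (Real.smoothTransition.contDiff.comp (contDiff_const.sub contDiff_id)).neg

lemma kernelPrimitive_of_one_le {s : ℝ} (hs : 1 ≤ s) : kernelPrimitive s = 0 := by
  rw [kernelPrimitive, intervalIntegral.integral_congr (g := fun _ => 0)]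
  · simp
  · intro t ht
    rw [uIcc_of_le hs] at ht
    exact Real.smoothTransition.zero_of_nonpos (by linarith [ht.1])

variable {E : Type*} [NormedAddCommGroup E] [InnerProductSpace ℝ E]

/-- A smooth radial weight, positive on the open unit ball and zero elsewhere. -/
noncomputable def radialKernel (y : E) : ℝ := Real.smoothTransition (1 - ‖y‖ ^ 2)

lemma contDiff_radialKernel : ContDiff ℝ ∞ (radialKernel : E → ℝ) :=
  Real.smoothTransition.contDiff.comp (contDiff_const.sub (contDiff_norm_sq ℝ))

omit [InnerProductSpace ℝ E] in
lemma radialKernel_nonneg (y : E) : 0 ≤ radialKernel y := Real.smoothTransition.nonneg _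

omit [InnerProductSpace ℝ E] in
lemma radialKernel_pos {y : E} (hy : ‖y‖ < 1) : 0 < radialKernel y := by
  apply Real.smoothTransition.pos_of_pos
  nlinarith [norm_nonneg y]

omit [InnerProductSpace ℝ E] in
lemma radialKernel_eq_zero {y : E} (hy : 1 ≤ ‖y‖) : radialKernel y = 0 := by
  apply Real.smoothTransition.zero_of_nonpos
  nlinarith [norm_nonneg y]

lemma hasCompactSupport_radialKernel [FiniteDimensional ℝ E] :
    HasCompactSupport (radialKernel : E → ℝ) :=
  HasCompactSupport.intro (isCompact_closedBall 0 1) fun y hy =>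
    radialKernel_eq_zero (by simpa using (not_le.1 (mt mem_closedBall_zero_iff.2 hy)).le)

omit [InnerProductSpace ℝ E] in
lemma tsupport_radialKernel_subset : tsupport (radialKernel : E → ℝ) ⊆ closedBall 0 1 := by
  refine closure_minimal (fun y hy => ?_) isClosed_closedBall
  by_contra h
  exact hy (radialKernel_eq_zero (by simpa using (not_le.1 (mt mem_closedBall_zero_iff.2 h)).le))

/-- The potential of the vector field `-2 radialKernel(y) y`. -/
noncomputable def kernelPotential (y : E) : ℝ := kernelPrimitive (‖y‖ ^ 2)

lemma contDiff_kernelPotential : ContDiff ℝ 2 (kernelPotential : E → ℝ) :=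
  contDiff_kernelPrimitive.comp (contDiff_norm_sq ℝ)

omit [InnerProductSpace ℝ E] in
lemma kernelPotential_eq_zero {y : E} (hy : 1 ≤ ‖y‖) : kernelPotential y = 0 :=
  kernelPrimitive_of_one_le (by nlinarith [norm_nonneg y])

omit [InnerProductSpace ℝ E] in
lemma tsupport_kernelPotential_subset :
    tsupport (kernelPotential : E → ℝ) ⊆ closedBall 0 1 := by
  refine closure_minimal (fun y hy => ?_) isClosed_closedBall
  by_contra h
  exact hy (kernelPotential_eq_zero (by simpa using (not_le.1 (mt mem_closedBall_zero_iff.2 h)).le))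

lemma hasCompactSupport_kernelPotential [FiniteDimensional ℝ E] :
    HasCompactSupport (kernelPotential : E → ℝ) :=
  (isCompact_closedBall 0 1).of_isClosed_subset (isClosed_tsupport _)
    tsupport_kernelPotential_subset

lemma fderiv_kernelPotential (y v : E) :
    fderiv ℝ kernelPotential y v = -2 * (radialKernel y * inner ℝ y v) := by
  have h := (hasDerivAt_kernelPrimitive (‖y‖ ^ 2)).comp_hasFDerivAt y
    (hasStrictFDerivAt_norm_sq y).hasFDerivAt
  have e : fderiv ℝ kernelPotential y = _ := h.fderiv
  rw [e]
  simp [radialKernel]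
  ring

end Kernel

/-! ### The weighted mean value property. -/

section MeanValue

open MeasureTheory Metric Set Filter Topology
open scoped ContDiff

variable {ι : Type*} [Fintype ι] [DecidableEq ι]
  {V : Type*} [NormedAddCommGroup V] [InnerProductSpace ℝ V] [CompleteSpace V]
  {L L' : ι → V →L[ℝ] V}

omit [DecidableEq ι] in
lemma integral_radialKernel_pos : 0 < ∫ y : EuclideanSpace ℝ ι, radialKernel y :=
  contDiff_radialKernel.continuous.integral_pos_of_hasCompactSupport_nonneg_nonzero
    hasCompactSupport_radialKernel radialKernel_nonneg (x := 0)
    (radialKernel_pos (by simp)).ne'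

omit [CompleteSpace V] in
lemma ContinuousLinearMap.apply_eq_sum_single (A : EuclideanSpace ℝ ι →L[ℝ] V)
    (y : EuclideanSpace ℝ ι) : A y = ∑ j, y j • A (EuclideanSpace.single j 1) := by
  have hy : ∑ j, y j • EuclideanSpace.single j (1 : ℝ) = y := by
    simpa using (EuclideanSpace.basisFun ι ℝ).sum_repr y
  conv_lhs => rw [← hy]
  simp only [map_sum, map_smul]

/-- This is weak harmonicity tested against `kernelPotential`, whose gradient is `-2 radialKernel(y)
y`: the trace sum becomes the derivative of `F` in the radial direction `y`. -/
lemma integral_radialKernel_smul_fderiv_eq_zero (hL : IsCliffordPair L L')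
    {F : EuclideanSpace ℝ ι → V} (hF : ContDiff ℝ 1 F)
    {x : EuclideanSpace ℝ ι} {t : ℝ} (hD : ∀ y ∈ closedBall (0 : EuclideanSpace ℝ ι) 1,
      dirac L F (x + t • y) = 0) :
    ∫ y, radialKernel y • fderiv ℝ F (x + t • y) y = 0 := by
  -- `G` is the rescaled `y ↦ F (x + t • y)`. At `t = 0` that function is constant and carries no
  -- information, so the differential of `F` at `x` replaces it.
  obtain ⟨G, hG, hGF⟩ : ∃ G : EuclideanSpace ℝ ι → V, ContDiff ℝ 1 G ∧
      ∃ c : ℝ, c ≠ 0 ∧ ∀ y, fderiv ℝ G y = c • fderiv ℝ F (x + t • y) := by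
    rcases eq_or_ne t 0 with rfl | ht
    · refine ⟨fderiv ℝ F x, (fderiv ℝ F x).contDiff, 1, one_ne_zero, fun y => ?_⟩
      simp
    · refine ⟨fun y => F (x + t • y), hF.comp (by fun_prop), t, ht, fun y => ?_⟩
      have h1 : HasFDerivAt (fun y : EuclideanSpace ℝ ι => x + t • y)
          (t • ContinuousLinearMap.id ℝ _) y :=
        ((hasFDerivAt_id y).const_smul t).const_add x
      have h2 := ((hF.differentiable (by norm_num)) (x + t • y)).hasFDerivAt.comp y h1
      rw [show (fun y => F (x + t • y)) = F ∘ fun y => x + t • y from rfl, h2.fderiv]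
      ext; simp
  obtain ⟨c, hc, hGF⟩ := hGF
  have hGD : ∀ y ∈ tsupport (kernelPotential : EuclideanSpace ℝ ι → ℝ), dirac L G y = 0 := by
    intro y hy
    have := hD y (tsupport_kernelPotential_subset hy)
    simp only [dirac, hGF, smul_apply, map_smul, ← Finset.smul_sum] at this ⊢
    rw [this, smul_zero]
  have key := sum_integral_fderiv_smul_fderiv_eq_zero hL contDiff_kernelPotential
    hasCompactSupport_kernelPotential hG hGD
  rw [← integral_finsetSum] at key
  · have e (y : EuclideanSpace ℝ ι) : ∑ j, fderiv ℝ kernelPotential y (EuclideanSpace.single j 1) •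
        fderiv ℝ G y (EuclideanSpace.single j 1)
        = (-2 * c) • (radialKernel y • fderiv ℝ F (x + t • y) y) := by
      rw [ContinuousLinearMap.apply_eq_sum_single (fderiv ℝ F (x + t • y)) y]
      simp only [Finset.smul_sum, hGF, fderiv_kernelPotential, smul_smul, smul_apply]
      refine Finset.sum_congr rfl fun j _ => ?_
      congr 1
      simp [EuclideanSpace.inner_single_right]
      ring
    simp_rw [e, integral_smul] at key
    exact (smul_eq_zero.1 key).resolve_left (by simpa using hc)
  · intro j _
    exact integrable_smul_of_hasCompactSupport
      ((contDiff_kernelPotential.continuous_fderiv (by norm_num)).clm_apply continuous_const)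
      (hasCompactSupport_kernelPotential.fderiv_apply ℝ _)
      ((hG.continuous_fderiv (by norm_num)).clm_apply continuous_const)

omit [DecidableEq ι] [CompleteSpace V] in
lemma hasDerivAt_integral_radialKernel_smul {F : EuclideanSpace ℝ ι → V} (hF : ContDiff ℝ 1 F)
    (x : EuclideanSpace ℝ ι) (t : ℝ) :
    HasDerivAt (fun s : ℝ => ∫ y, radialKernel y • F (x + s • y))
      (∫ y, radialKernel y • fderiv ℝ F (x + t • y) y) t := by
  have hF' := hF.continuous_fderiv (by norm_num)
  -- For `s` within `1` of `t` and `‖y‖ < 1` the point `x + s • y` stays in this compact ball, which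
  -- yields the dominating function.
  obtain ⟨C, hC⟩ := (isCompact_closedBall x (|t| + 1)).exists_bound_of_continuousOn hF'.continuousOn
  have hw : Continuous (radialKernel : EuclideanSpace ℝ ι → ℝ) := contDiff_radialKernel.continuous
  refine (hasDerivAt_integral_of_dominated_loc_of_deriv_le
    (bound := fun y => radialKernel y • C) (ball_mem_nhds t one_pos)
    (F' := fun s y => radialKernel y • fderiv ℝ F (x + s • y) y) ?_ ?_ ?_ ?_ ?_ ?_).2
  · refine Eventually.of_forall fun s => Continuous.aestronglyMeasurable ?_
    exact hw.smul (hF.continuous.comp (by fun_prop))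
  · exact integrable_smul_of_hasCompactSupport hw hasCompactSupport_radialKernel
      (hF.continuous.comp (by fun_prop))
  · refine Continuous.aestronglyMeasurable ?_
    exact hw.smul ((hF'.comp (by fun_prop)).clm_apply continuous_id)
  · refine Eventually.of_forall fun y s hs => ?_
    rw [norm_smul, Real.norm_of_nonneg (radialKernel_nonneg y)]
    rcases le_or_gt 1 ‖y‖ with hy | hy
    · simp [radialKernel_eq_zero hy]
    · refine mul_le_mul_of_nonneg_left ?_ (radialKernel_nonneg y)
      have hs' : |s| ≤ |t| + 1 := by
        have h1 : |s - t| < 1 := by simpa [Real.dist_eq] using hs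
        have h2 := abs_add_le (s - t) t
        rw [sub_add_cancel] at h2
        linarith
      have hmem : x + s • y ∈ closedBall x (|t| + 1) := by
        simp only [mem_closedBall, dist_self_add_left, norm_smul, Real.norm_eq_abs]
        nlinarith [abs_nonneg s, norm_nonneg y]
      have h1 := (fderiv ℝ F (x + s • y)).le_opNorm y
      have h2 := hC _ hmem
      nlinarith [norm_nonneg y, norm_nonneg (fderiv ℝ F (x + s • y))]
  · exact integrable_smul_of_hasCompactSupport hw hasCompactSupport_radialKernel continuous_const
  · refine Eventually.of_forall fun y s _ => HasDerivAt.const_smul _ ?_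
    have h1 : HasDerivAt (fun s : ℝ => x + s • y) y s := by
      simpa using ((hasDerivAt_id s).smul_const y).const_add x
    exact ((hF.differentiable (by norm_num)) (x + s • y)).hasFDerivAt.comp_hasDerivAt s h1

/-- The weighted mean at radius `t` has zero derivative in `t`, and at `t = 0` it is the total
weight times `F x`. -/
lemma integral_radialKernel_smul_of_contDiff (hL : IsCliffordPair L L')
    {F : EuclideanSpace ℝ ι → V} (hF : ContDiff ℝ 1 F) {x : EuclideanSpace ℝ ι} {r : ℝ}
    (hr : 0 ≤ r) (hD : ∀ y ∈ closedBall x r, dirac L F y = 0) :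
    ∫ y : EuclideanSpace ℝ ι, radialKernel y • F (x + r • y)
      = (∫ y : EuclideanSpace ℝ ι, radialKernel y) • F x := by
  have hd := hasDerivAt_integral_radialKernel_smul hF x
  have h := constant_of_has_deriv_right_zero
    (f := fun s : ℝ => ∫ y : EuclideanSpace ℝ ι, radialKernel y • F (x + s • y))
    (a := 0) (b := r) (fun t _ => (hd t).continuousAt.continuousWithinAt) ?_ r ⟨hr, le_rfl⟩
  · rw [h, ← integral_smul_const]
    simp
  · intro t ht
    have := (hd t).hasDerivWithinAt (s := Ici t)
    rwa [integral_radialKernel_smul_fderiv_eq_zero hL hF] at this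
    intro y hy
    apply hD
    rw [mem_closedBall_zero_iff] at hy
    rw [mem_closedBall, dist_self_add_left, norm_smul, Real.norm_of_nonneg ht.1]
    nlinarith [norm_nonneg y, ht.1, ht.2]

end MeanValue

/-! ### Local mean value property and smoothness. -/

section Regularity

open MeasureTheory Metric Set Filter Topology
open scoped ContDiff

variable {ι : Type*} [Fintype ι] [DecidableEq ι]
  {V : Type*} [NormedAddCommGroup V] [InnerProductSpace ℝ V] [CompleteSpace V]
  {L L' : ι → V →L[ℝ] V} {F : EuclideanSpace ℝ ι → V}

-- A cutoff replaces a local solution by a global `C¹` function, as the integrals over the whole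
-- space require. Agreement on a ball of radius strictly above `r` preserves derivatives on the
-- closed ball of radius `r`.
omit [DecidableEq ι] [CompleteSpace V] in
lemma ContDiffOn.exists_contDiff_eqOn_ball {x : EuclideanSpace ℝ ι} {r R : ℝ}
    (hF : ContDiffOn ℝ 1 F (ball x R)) (hr : 0 ≤ r) (hrR : r < R) :
    ∃ G : EuclideanSpace ℝ ι → V, ContDiff ℝ 1 G ∧ ∃ ρ > r, EqOn G F (ball x ρ) := by
  let η : ContDiffBump x :=
    { rIn := r + (R - r) / 3, rOut := r + 2 * (R - r) / 3
      rIn_pos := by linarith, rIn_lt_rOut := by linarith }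
  refine ⟨fun y => η y • F y, contDiff_iff_contDiffAt.2 fun y => ?_, r + (R - r) / 3,
    by linarith, fun y hy => ?_⟩
  · by_cases hy : y ∈ ball x R
    · exact η.contDiffAt.smul (hF.contDiffAt (isOpen_ball.mem_nhds hy))
    · have hy' : y ∉ tsupport η := by
        rw [η.tsupport_eq]
        intro h
        simp only [mem_ball, not_lt, mem_closedBall] at hy h
        have : η.rOut = r + 2 * (R - r) / 3 := rfl
        linarith
      refine (contDiffAt_const (c := (0 : V))).congr_of_eventuallyEq ?_
      filter_upwards [notMem_tsupport_iff_eventuallyEq.1 hy'] with z hz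
      simp [hz]
  · simp [η.one_of_mem_closedBall (ball_subset_closedBall hy)]

omit [CompleteSpace V] in
lemma dirac_congr {F G : EuclideanSpace ℝ ι → V} {x : EuclideanSpace ℝ ι}
    (h : F =ᶠ[𝓝 x] G) : dirac L F x = dirac L G x := by
  simp only [dirac, h.fderiv_eq]

omit [CompleteSpace V] in
lemma IsMonogenicOn.mono {U W : Set (EuclideanSpace ℝ ι)} (hF : IsMonogenicOn L F U)
    (h : W ⊆ U) : IsMonogenicOn L F W :=
  ⟨hF.contDiffOn.mono h, fun x hx => hF.dirac_eq_zero x (h hx)⟩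

/-- The mean value property. -/
lemma IsMonogenicOn.integral_radialKernel_smul (hL : IsCliffordPair L L')
    {x : EuclideanSpace ℝ ι} {r R : ℝ} (hF : IsMonogenicOn L F (ball x R))
    (hr : 0 ≤ r) (hrR : r < R) :
    ∫ y : EuclideanSpace ℝ ι, radialKernel y • F (x + r • y)
      = (∫ y : EuclideanSpace ℝ ι, radialKernel y) • F x := by
  obtain ⟨G, hG, ρ, hρ, hGF⟩ := hF.contDiffOn.exists_contDiff_eqOn_ball hr hrR
  have hGF' : EqOn G F (closedBall x r) := fun y hy => hGF (closedBall_subset_ball hρ hy)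
  rw [← hGF' (mem_closedBall_self hr), ← integral_radialKernel_smul_of_contDiff hL hG hr]
  · congr 1
    ext1 y
    rcases le_or_gt 1 ‖y‖ with hy | hy
    · simp [radialKernel_eq_zero hy]
    · rw [hGF']
      rw [mem_closedBall, dist_self_add_left, norm_smul, Real.norm_of_nonneg hr]
      nlinarith [norm_nonneg y]
  · intro y hy
    rw [dirac_congr (hGF.eventuallyEq_of_mem (isOpen_ball.mem_nhds (closedBall_subset_ball hρ hy)))]
    exact hF.dirac_eq_zero y (closedBall_subset_ball hrR hy)

/-- At a fixed radius the mean value property writes `F` locally as a convolution with a smooth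
compactly supported kernel. -/
lemma IsMonogenicOn.contDiffOn_infty (hL : IsCliffordPair L L') {U : Set (EuclideanSpace ℝ ι)}
    (hU : IsOpen U) (hF : IsMonogenicOn L F U) : ContDiffOn ℝ ∞ F U := by
  intro x₀ hx₀
  apply ContDiffAt.contDiffWithinAt
  obtain ⟨R, hR, hRU⟩ := Metric.isOpen_iff.1 hU x₀ hx₀
  -- For `x` within `r` of `x₀`, the averaging ball of radius `r` about `x` stays within `2r < R` of
  -- `x₀`, where `G = F`.
  set r := R / 3 with hr
  have hr0 : 0 < r := by positivity
  obtain ⟨G, hG, ρ, hρ, hGF⟩ := (hF.contDiffOn.mono hRU).exists_contDiff_eqOn_ball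
    (r := 2 * r) (by positivity) (by linarith)
  set k : EuclideanSpace ℝ ι → ℝ := fun u => radialKernel (r⁻¹ • u) with hk
  have hkc : HasCompactSupport k := hasCompactSupport_radialKernel.comp_smul (inv_ne_zero hr0.ne')
  have hks : ContDiff ℝ ∞ k := contDiff_radialKernel.comp (contDiff_const_smul _)
  have hconv : ContDiff ℝ ∞ (convolution G k (ContinuousLinearMap.lsmul ℝ ℝ).flip volume) :=
    hkc.contDiff_convolution_right _ hG.continuous.locallyIntegrable hks
  have hconv_eq (x : EuclideanSpace ℝ ι) :
      ∫ y : EuclideanSpace ℝ ι, radialKernel y • G (x + r • y)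
      = |(r ^ Module.finrank ℝ (EuclideanSpace ℝ ι))⁻¹| •
        convolution G k (ContinuousLinearMap.lsmul ℝ ℝ).flip volume x := by
    have h1 := Measure.integral_comp_smul volume
      (fun z : EuclideanSpace ℝ ι => radialKernel (r⁻¹ • z) • G (x + z)) r
    simp only [inv_smul_smul₀ hr0.ne'] at h1
    rw [h1, convolution]
    congr 1
    rw [← integral_add_left_eq_self
      (fun t => (ContinuousLinearMap.lsmul ℝ ℝ).flip (G t) (k (x - t))) x]
    congr 1
    ext1 z
    simp [hk, radialKernel, norm_smul]
  set c : ℝ := ∫ y : EuclideanSpace ℝ ι, radialKernel y with hc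
  have hc0 : c ≠ 0 := integral_radialKernel_pos.ne'
  refine (contDiff_const.smul hconv).contDiffAt (f := fun x =>
    (c⁻¹ * |(r ^ Module.finrank ℝ (EuclideanSpace ℝ ι))⁻¹|) •
      convolution G k (ContinuousLinearMap.lsmul ℝ ℝ).flip volume x)
    |>.congr_of_eventuallyEq ?_
  filter_upwards [ball_mem_nhds x₀ hr0] with x hx
  rw [mem_ball] at hx
  rw [mul_smul, ← hconv_eq, integral_radialKernel_smul_of_contDiff hL hG hr0.le,
    inv_smul_smul₀ hc0]
  · exact (hGF (mem_ball.2 (by linarith))).symm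
  · intro y hy
    have hy' : dist y x₀ < 2 * r := by
      linarith [dist_triangle y x x₀, mem_closedBall.1 hy]
    rw [dirac_congr (hGF.eventuallyEq_of_mem (isOpen_ball.mem_nhds
      (mem_ball.2 (hy'.trans hρ))))]
    exact hF.dirac_eq_zero y (hRU (mem_ball.2 (by linarith)))

/-- Directional derivatives of monogenic functions are monogenic. -/
lemma IsMonogenicOn.fderiv_apply (hL : IsCliffordPair L L') {U : Set (EuclideanSpace ℝ ι)}
    (hU : IsOpen U) (hF : IsMonogenicOn L F U) (v : EuclideanSpace ℝ ι) :
    IsMonogenicOn L (fun x => fderiv ℝ F x v) U := by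
  have hs := hF.contDiffOn_infty hL hU
  have hs1 : ContDiffOn ℝ 1 (fderiv ℝ F) U := hs.fderiv_of_isOpen hU (by norm_cast)
  refine ⟨hs1.clm_apply contDiffOn_const, fun x hx => ?_⟩
  have hx' := hU.mem_nhds hx
  have hd : DifferentiableAt ℝ (fderiv ℝ F) x :=
    (hs1.contDiffAt hx').differentiableAt (by norm_num)
  have hsymm : IsSymmSndFDerivAt ℝ F x := (hs.contDiffAt hx').isSymmSndFDerivAt
    (by rw [minSmoothness_of_isRCLikeNormedField]; exact WithTop.coe_le_coe.2 (le_top (a := (2 : ℕ∞))))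
  have e (u v) : fderiv ℝ (fun z => fderiv ℝ F z v) x u = fderiv ℝ (fderiv ℝ F) x u v := by
    rw [fderiv_clm_apply hd (by fun_prop)]
    simp
  have h0 : fderiv ℝ (dirac L F) x v = 0 := by
    have : dirac L F =ᶠ[𝓝 x] fun _ => 0 := by
      filter_upwards [hx'] with y hy using hF.dirac_eq_zero y hy
    rw [this.fderiv_eq]; simp
  have h1 : HasFDerivAt (dirac L F)
      (∑ i, (L i).comp (((ContinuousLinearMap.apply ℝ V (EuclideanSpace.single i 1))).comp
        (fderiv ℝ (fderiv ℝ F) x))) x := by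
    refine HasFDerivAt.fun_sum fun i _ => (L i).hasFDerivAt.comp x ?_
    exact (ContinuousLinearMap.apply ℝ V
      (EuclideanSpace.single i (1 : ℝ))).hasFDerivAt.comp x hd.hasFDerivAt
  rw [h1.fderiv] at h0
  simp only [dirac, e]
  rw [← h0]
  simp [hsymm _ v]

end Regularity

/-! ### Interior estimates, unique continuation and the local maximum principle. -/

section UniqueContinuation

open MeasureTheory Metric Set Filter Topology
open scoped ContDiff

variable {ι : Type*} [Fintype ι] [DecidableEq ι]
  {V : Type*} [NormedAddCommGroup V] [InnerProductSpace ℝ V] [CompleteSpace V]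
  {L L' : ι → V →L[ℝ] V}

/-- A Cauchy estimate: the mean value property is applied to the derivative of `F`, and integration
by parts moves that derivative onto the weight. `K` must not depend on `F` or `R`, since the
estimate is iterated. -/
lemma exists_norm_fderiv_apply_le (hL : IsCliffordPair L L') :
    ∃ K : ℝ, 0 ≤ K ∧ ∀ (F : EuclideanSpace ℝ ι → V) (x v : EuclideanSpace ℝ ι) (R M : ℝ),
      0 < R → IsMonogenicOn L F (ball x R) → (∀ y ∈ ball x R, ‖F y‖ ≤ M) →
      ‖fderiv ℝ F x v‖ ≤ K * ‖v‖ / R * M := by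
  set w : EuclideanSpace ℝ ι → ℝ := radialKernel with hw
  have hws : ContDiff ℝ ∞ w := contDiff_radialKernel
  have hwc : HasCompactSupport w := hasCompactSupport_radialKernel
  have hw' : Continuous (fderiv ℝ w) := hws.continuous_fderiv (by simp)
  have hw'c : HasCompactSupport (fderiv ℝ w) := hwc.fderiv ℝ
  have hw0 (y) (hy : 1 < ‖y‖) : fderiv ℝ w y = 0 := by
    by_contra h
    have := mem_closedBall_zero_iff.1
      (tsupport_radialKernel_subset (support_fderiv_subset ℝ (f := w) h))
    linarith
  set c : ℝ := ∫ y, w y with hc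
  have hc0 : 0 < c := integral_radialKernel_pos
  set K₀ : ℝ := ∫ y, ‖fderiv ℝ w y‖ with hK₀
  have hK₀0 : 0 ≤ K₀ := integral_nonneg fun _ => norm_nonneg _
  -- The factor `2` comes from averaging at radius `R / 2`.
  refine ⟨2 * K₀ / c, by positivity, fun F x v R M hR hF hM => ?_⟩
  set r := R / 2 with hr
  have hr0 : 0 < r := by positivity
  have hrR : r < R := by linarith
  obtain ⟨G, hG, ρ, hρ, hGF⟩ := hF.contDiffOn.exists_contDiff_eqOn_ball hr0.le hrR
  have hmem {y : EuclideanSpace ℝ ι} (hy : ‖y‖ ≤ 1) : x + r • y ∈ closedBall x r := by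
    rw [mem_closedBall, dist_self_add_left, norm_smul, Real.norm_of_nonneg hr0.le]
    nlinarith [norm_nonneg y]
  have hmvp := (hF.fderiv_apply hL isOpen_ball v).integral_radialKernel_smul hL hr0.le hrR
  set H : EuclideanSpace ℝ ι → V := fun y => G (x + r • y) with hH
  have hHs : ContDiff ℝ 1 H := hG.comp (by fun_prop)
  have hH' (y) : fderiv ℝ H y v = r • fderiv ℝ G (x + r • y) v := by
    have h1 : HasFDerivAt (fun y : EuclideanSpace ℝ ι => x + r • y)
        (r • ContinuousLinearMap.id ℝ _) y :=
      ((hasFDerivAt_id y).const_smul r).const_add x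
    have h2 := ((hG.differentiable (by norm_num)) (x + r • y)).hasFDerivAt.comp y h1
    rw [show H = G ∘ fun y => x + r • y from rfl, h2.fderiv]
    simp
  have hibp : ∫ y, w y • fderiv ℝ H y v = - ∫ y, fderiv ℝ w y v • H y := by
    apply integral_smul_fderiv_eq_neg_fderiv_smul_of_integrable
    · exact integrable_smul_of_hasCompactSupport (hw'.clm_apply continuous_const)
        (hwc.fderiv_apply ℝ v) hHs.continuous
    · exact integrable_smul_of_hasCompactSupport hws.continuous hwc
        ((hHs.continuous_fderiv (by norm_num)).clm_apply continuous_const)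
    · exact integrable_smul_of_hasCompactSupport hws.continuous hwc hHs.continuous
    · exact fun x _ => (hws.differentiable (by simp)) x
    · exact fun x _ => (hHs.differentiable (by norm_num)) x
  have hlhs : ∫ y, w y • fderiv ℝ H y v = (r * c) • fderiv ℝ F x v := by
    rw [mul_smul, ← hmvp, ← integral_smul]
    congr 1
    ext1 y
    rcases le_or_gt 1 ‖y‖ with hy | hy
    · simp [hw, radialKernel_eq_zero hy]
    · rw [hH', smul_comm, (hGF.eventuallyEq_of_mem (isOpen_ball.mem_nhds
        (closedBall_subset_ball hρ (hmem hy.le)))).fderiv_eq]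
  have hrhs : ‖∫ y, fderiv ℝ w y v • H y‖ ≤ K₀ * (‖v‖ * M) := by
    rw [hK₀, ← integral_mul_const]
    refine norm_integral_le_of_norm_le
      ((hw'.norm.integrable_of_hasCompactSupport hw'c.norm).mul_const _)
      (Eventually.of_forall fun y => ?_)
    rcases lt_or_ge 1 ‖y‖ with hy | hy
    · simp [hw0 y hy]
    · rw [norm_smul, ← mul_assoc]
      refine mul_le_mul ((fderiv ℝ w y).le_opNorm v) ?_ (norm_nonneg _) (by positivity)
      simp only [hH]
      rw [hGF (closedBall_subset_ball hρ (hmem hy))]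
      exact hM _ (closedBall_subset_ball hrR (hmem hy))
  have h := congrArg norm (hlhs.symm.trans hibp)
  rw [norm_neg, norm_smul, Real.norm_of_nonneg (by positivity)] at h
  rw [← h] at hrhs
  rw [show 2 * K₀ / c * ‖v‖ / R * M = K₀ * (‖v‖ * M) / (r * c) by rw [hr]; field_simp,
    le_div_iff₀ (by positivity)]
  linarith

/-- The derivative of `F` in the direction `v`. -/
noncomputable def dirDeriv (v : EuclideanSpace ℝ ι) (F : EuclideanSpace ℝ ι → V) :
    EuclideanSpace ℝ ι → V := fun x => fderiv ℝ F x v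

lemma IsMonogenicOn.iterate_dirDeriv (hL : IsCliffordPair L L') {U : Set (EuclideanSpace ℝ ι)}
    (hU : IsOpen U) (v : EuclideanSpace ℝ ι) (k : ℕ) {F : EuclideanSpace ℝ ι → V}
    (hF : IsMonogenicOn L F U) : IsMonogenicOn L ((dirDeriv v)^[k] F) U := by
  induction k generalizing F with
  | zero => exact hF
  | succ k ih => exact ih (hF.fderiv_apply hL hU v)

omit [Fintype ι] [DecidableEq ι] [CompleteSpace V] in
lemma iterate_dirDeriv_eqOn_zero {W : Set (EuclideanSpace ℝ ι)} (hW : IsOpen W)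
    (v : EuclideanSpace ℝ ι) (k : ℕ) {F : EuclideanSpace ℝ ι → V} (hF : ∀ x ∈ W, F x = 0) :
    ∀ x ∈ W, (dirDeriv v)^[k] F x = 0 := by
  induction k generalizing F with
  | zero => exact hF
  | succ k ih =>
    refine ih fun x hx => ?_
    have : F =ᶠ[𝓝 x] fun _ => 0 := by filter_upwards [hW.mem_nhds hx] with y hy using hF y hy
    rw [dirDeriv, this.fderiv_eq]
    simp

/-- Each derivative costs a margin `δ` of the radius and a factor `K * ‖v‖ / δ`. -/
lemma norm_iterate_dirDeriv_le (hL : IsCliffordPair L L') {K : ℝ}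
    (hK : ∀ (F : EuclideanSpace ℝ ι → V) (x v : EuclideanSpace ℝ ι) (R M : ℝ),
      0 < R → IsMonogenicOn L F (ball x R) → (∀ y ∈ ball x R, ‖F y‖ ≤ M) →
      ‖fderiv ℝ F x v‖ ≤ K * ‖v‖ / R * M)
    (v x₀ : EuclideanSpace ℝ ι) {δ : ℝ} (hδ : 0 < δ) (R : ℝ) (k : ℕ) :
    ∀ (F : EuclideanSpace ℝ ι → V) (M : ℝ), IsMonogenicOn L F (ball x₀ (R + k * δ)) →
      (∀ y ∈ ball x₀ (R + k * δ), ‖F y‖ ≤ M) →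
      ∀ x ∈ ball x₀ R, ‖(dirDeriv v)^[k] F x‖ ≤ (K * ‖v‖ / δ) ^ k * M := by
  induction k with
  | zero => intro F M _ hM x hx; simpa using hM x (by simpa using hx)
  | succ k ih =>
    intro F M hF hM x hx
    have hsub : ball x₀ (R + k * δ) ⊆ ball x₀ (R + (k + 1 : ℕ) * δ) :=
      ball_subset_ball (by push_cast; linarith)
    have hball {y} (hy : y ∈ ball x₀ (R + k * δ)) : ball y δ ⊆ ball x₀ (R + (k + 1 : ℕ) * δ) := by
      refine ball_subset_ball' ?_
      rw [mem_ball] at hy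
      push_cast
      linarith
    have := ih (dirDeriv v F) (K * ‖v‖ / δ * M) ((hF.fderiv_apply hL isOpen_ball v).mono hsub)
      (fun y hy => hK F y v δ M hδ (hF.mono (hball hy)) fun z hz => hM z (hball hy hz)) x hx
    rwa [← mul_assoc, ← pow_succ] at this

/-- Taylor's remainder bound along a segment, by induction: a bound on the derivative along `v` is
integrated from `x₀`, where `F` vanishes. -/
lemma norm_le_of_iterate_dirDeriv_eq_zero (hL : IsCliffordPair L L')
    {U : Set (EuclideanSpace ℝ ι)} (hU : IsOpen U) {x₀ v : EuclideanSpace ℝ ι}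
    (hseg : ∀ t ∈ Icc (0 : ℝ) 1, x₀ + t • v ∈ U) {A : ℝ} (k : ℕ) :
    ∀ F : EuclideanSpace ℝ ι → V, IsMonogenicOn L F U →
      (∀ j, (dirDeriv v)^[j] F x₀ = 0) →
      (∀ t ∈ Icc (0 : ℝ) 1, ‖(dirDeriv v)^[k] F (x₀ + t • v)‖ ≤ A) →
      ∀ t ∈ Icc (0 : ℝ) 1, ‖F (x₀ + t • v)‖ ≤ A * (t ^ k / k.factorial) := by
  induction k with
  | zero => intro F _ _ hA t ht; simpa using hA t ht
  | succ k ih =>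
    intro F hF h0 hA
    have hd := ih (dirDeriv v F) (hF.fderiv_apply hL hU v) (fun j => h0 (j + 1)) hA
    have hderiv (t : ℝ) (ht : t ∈ Icc (0 : ℝ) 1) :
        HasDerivAt (fun t : ℝ => F (x₀ + t • v)) (dirDeriv v F (x₀ + t • v)) t := by
      have h1 : HasDerivAt (fun s : ℝ => x₀ + s • v) v t := by
        simpa using ((hasDerivAt_id t).smul_const v).const_add x₀
      have h2 : DifferentiableAt ℝ F (x₀ + t • v) :=
        (hF.contDiffOn.contDiffAt (hU.mem_nhds (hseg t ht))).differentiableAt (by norm_num)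
      exact h2.hasFDerivAt.comp_hasDerivAt t h1
    refine image_norm_le_of_norm_deriv_right_le_deriv_boundary
      (f := fun t : ℝ => F (x₀ + t • v)) (f' := fun t => dirDeriv v F (x₀ + t • v))
      (B' := fun t => A * (t ^ k / k.factorial))
      (fun t ht => (hderiv t ht).continuousAt.continuousWithinAt)
      (fun t ht => (hderiv t ⟨ht.1, ht.2.le⟩).hasDerivWithinAt) ?_ (fun t => ?_)
      (fun t ht => hd t ⟨ht.1, ht.2.le⟩)
    · simpa using h0 0
    · have := (((hasDerivAt_pow (k + 1) t).div_const ((k + 1).factorial : ℝ))).const_mul A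
      refine this.congr_deriv ?_
      have hk : (k.factorial : ℝ) ≠ 0 := by positivity
      rw [Nat.factorial_succ]
      push_cast
      field_simp

/-- The Cauchy estimates grow like `k ^ k`, which the `k!` of Taylor's formula absorbs up to `e ^
k`. Close to `x₀` a geometric sequence tending to `0` remains. -/
lemma eventually_eq_zero_of_iterate_dirDeriv_eq_zero (hL : IsCliffordPair L L')
    {U : Set (EuclideanSpace ℝ ι)} (hU : IsOpen U) {x₀ : EuclideanSpace ℝ ι} (hx₀ : x₀ ∈ U)
    {F : EuclideanSpace ℝ ι → V} (hF : IsMonogenicOn L F U)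
    (h0 : ∀ v k, (dirDeriv v)^[k] F x₀ = 0) : ∃ ε > 0, ∀ x ∈ ball x₀ ε, F x = 0 := by
  obtain ⟨K, hK0, hK⟩ := exists_norm_fderiv_apply_le hL
  have hcont : ContinuousAt F x₀ := (hF.contDiffOn.contDiffAt (hU.mem_nhds hx₀)).continuousAt
  have hbd : ∀ᶠ y in 𝓝 x₀, y ∈ U ∧ ‖F y‖ < ‖F x₀‖ + 1 :=
    (hU.eventually_mem hx₀).and
      (hcont.norm.eventually_lt continuousAt_const (lt_add_one _))
  obtain ⟨R₁, hR₁, hb⟩ := Metric.eventually_nhds_iff_ball.1 hbd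
  set R := R₁ / 2 with hR
  have hR0 : 0 < R := by positivity
  set M := ‖F x₀‖ + 1 with hM
  have hM0 : 0 < M := by positivity
  have he := Real.exp_pos 1
  -- The second radius forces `q ≤ 1 / 2` below; `K + 1` in place of `K` keeps the denominator
  -- positive.
  refine ⟨min R (R / (2 * Real.exp 1 * (K + 1))), lt_min hR0 (by positivity), fun x hx => ?_⟩
  obtain ⟨v, rfl⟩ : ∃ v, x = x₀ + v := ⟨x - x₀, by abel⟩
  rw [mem_ball, dist_self_add_left, lt_min_iff,
    lt_div_iff₀ (by positivity : 0 < 2 * Real.exp 1 * (K + 1))] at hx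
  set q := Real.exp 1 * (K * ‖v‖ / R) with hq
  have hq0 : 0 ≤ q := by positivity
  have hq1 : q ≤ 1 / 2 := by
    rw [hq, ← mul_div_assoc, div_le_iff₀ hR0]
    nlinarith [norm_nonneg v, hx.2, mul_nonneg he.le (norm_nonneg v)]
  have hseg : ∀ t ∈ Icc (0 : ℝ) 1, x₀ + t • v ∈ ball x₀ R := by
    intro t ht
    rw [mem_ball, dist_self_add_left, norm_smul, Real.norm_of_nonneg ht.1]
    nlinarith [norm_nonneg v, ht.2, hx.1]
  have hFR : IsMonogenicOn L F (ball x₀ (2 * R)) :=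
    hF.mono fun y hy => (hb y (by rwa [hR, mul_div_cancel₀ _ two_ne_zero] at hy)).1
  have hest (k : ℕ) : ‖F (x₀ + v)‖ ≤ q ^ (k + 1) * M := by
    -- The `k + 1` margins together use exactly the gap between the radii `R` and `2 * R`.
    set δ : ℝ := R / (k + 1 : ℕ) with hδ
    have hk : (0 : ℝ) < (k + 1 : ℕ) := by positivity
    have hδ0 : 0 < δ := by positivity
    have hRδ : R + (k + 1 : ℕ) * δ = 2 * R := by rw [hδ]; field_simp; norm_num
    have h1 := norm_iterate_dirDeriv_le hL hK v x₀ hδ0 R (k + 1) F M (by rwa [hRδ])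
      (by
        rw [hRδ]
        intro y hy
        exact (hb y (by rwa [hR, mul_div_cancel₀ _ two_ne_zero] at hy)).2.le)
    have h2 := norm_le_of_iterate_dirDeriv_eq_zero hL isOpen_ball hseg (k + 1) F
      (hFR.mono (ball_subset_ball (by linarith))) (h0 v) (fun t ht => h1 _ (hseg t ht))
      1 ⟨zero_le_one, le_rfl⟩
    rw [one_smul, one_pow] at h2
    refine h2.trans ?_
    have h3 := Real.pow_div_factorial_le_exp _ hk.le (k + 1)
    have h4 : Real.exp ((k + 1 : ℕ) : ℝ) = Real.exp 1 ^ (k + 1) := by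
      rw [← Real.exp_nat_mul, mul_one]
    have h5 : (K * ‖v‖ / δ) ^ (k + 1) * M * (1 / ((k + 1).factorial : ℝ))
        = (((k + 1 : ℕ) : ℝ) ^ (k + 1) / (k + 1).factorial) * (K * ‖v‖ / R) ^ (k + 1) * M := by
      rw [hδ, show K * ‖v‖ / (R / ((k + 1 : ℕ) : ℝ)) = ((k + 1 : ℕ) : ℝ) * (K * ‖v‖ / R) by
        field_simp, mul_pow]
      ring
    rw [h5, hq, mul_pow, ← h4]
    gcongr
  have hlim : Tendsto (fun k : ℕ => q ^ (k + 1) * M) atTop (𝓝 (0 * M)) :=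
    ((tendsto_pow_atTop_nhds_zero_of_lt_one hq0 (by linarith)).comp
      (tendsto_add_atTop_nat 1)).mul_const M
  have := ge_of_tendsto' hlim hest
  rw [zero_mul] at this
  exact norm_le_zero_iff.1 this

/-- Unique continuation from a point where all iterated directional derivatives vanish. -/
lemma IsMonogenicOn.eq_zero_of_isPreconnected (hL : IsCliffordPair L L')
    {U : Set (EuclideanSpace ℝ ι)} (hU : IsOpen U) (hUc : IsPreconnected U)
    {F : EuclideanSpace ℝ ι → V} (hF : IsMonogenicOn L F U)
    {x₀ : EuclideanSpace ℝ ι} (hx₀ : x₀ ∈ U) (h0 : ∀ v k, (dirDeriv v)^[k] F x₀ = 0) :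
    ∀ x ∈ U, F x = 0 := by
  -- The set of zeros of infinite order is open by the local result and relatively closed by
  -- continuity of every iterated derivative.
  set Z : Set (EuclideanSpace ℝ ι) := {x | x ∈ U ∧ ∀ v k, (dirDeriv v)^[k] F x = 0} with hZ
  have hZo : IsOpen Z := by
    rw [isOpen_iff_mem_nhds]
    rintro x ⟨hx, hx0⟩
    obtain ⟨ε, hε, h⟩ := eventually_eq_zero_of_iterate_dirDeriv_eq_zero hL hU hx hF hx0
    filter_upwards [hU.mem_nhds hx, ball_mem_nhds x hε] with y hy hy'
    exact ⟨hy, fun v k => iterate_dirDeriv_eqOn_zero isOpen_ball v k h y hy'⟩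
  have hsub : U ⊆ Z := by
    refine hUc.subset_of_closure_inter_subset hZo ⟨x₀, hx₀, hx₀, h0⟩ ?_
    rintro x ⟨hxZ, hxU⟩
    refine ⟨hxU, fun v k => ?_⟩
    have hc : ContinuousAt ((dirDeriv v)^[k] F) x :=
      ((hF.iterate_dirDeriv hL hU v k).contDiffOn.contDiffAt (hU.mem_nhds hxU)).continuousAt
    have := hc.continuousWithinAt.mem_closure (t := {0}) hxZ (fun y hy => hy.2 v k)
    simpa using this
  exact fun x hx => (hsub hx).2 0 0

/-- A monogenic function whose modulus has a local maximum is locally constant there. -/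
lemma IsMonogenicOn.eventually_eq_of_isLocalMax_norm (hL : IsCliffordPair L L')
    {U : Set (EuclideanSpace ℝ ι)} (hU : IsOpen U) {F : EuclideanSpace ℝ ι → V}
    (hF : IsMonogenicOn L F U) {x : EuclideanSpace ℝ ι} (hx : x ∈ U)
    (hmax : IsLocalMax (fun y => ‖F y‖) x) : ∃ ε > 0, ball x ε ⊆ U ∧ ∀ y ∈ ball x ε, F y = F x := by
  obtain ⟨R, hR, hb⟩ := Metric.eventually_nhds_iff_ball.1
    ((hU.eventually_mem hx).and hmax)
  have hFR : IsMonogenicOn L F (ball x R) := hF.mono fun y hy => (hb y hy).1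
  set r := R / 2 with hr
  have hr0 : 0 < r := by positivity
  have hrR : r < R := by linarith
  refine ⟨r, hr0, fun y hy => (hb y (ball_subset_ball hrR.le hy)).1, ?_⟩
  obtain ⟨G, hG, ρ, hρ, hGF⟩ := hFR.contDiffOn.exists_contDiff_eqOn_ball hr0.le hrR
  have hmem {y : EuclideanSpace ℝ ι} (hy : ‖y‖ < 1) : x + r • y ∈ ball x r := by
    rw [mem_ball, dist_self_add_left, norm_smul, Real.norm_of_nonneg hr0.le]
    nlinarith [norm_nonneg y]
  have hGF' {y : EuclideanSpace ℝ ι} (hy : ‖y‖ < 1) : G (x + r • y) = F (x + r • y) :=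
    hGF (ball_subset_ball hρ.le (hmem hy))
  have hw : Continuous (radialKernel : EuclideanSpace ℝ ι → ℝ) := contDiff_radialKernel.continuous
  have hwc := hasCompactSupport_radialKernel (E := EuclideanSpace ℝ ι)
  have hGc : Continuous fun y : EuclideanSpace ℝ ι => G (x + r • y) :=
    hG.continuous.comp (by fun_prop)
  have hmvp := hFR.integral_radialKernel_smul hL hr0.le hrR
  -- `d` is continuous, nonnegative by maximality and of integral zero by the mean value property,
  -- so it vanishes identically.
  set d : EuclideanSpace ℝ ι → ℝ := fun y =>
    radialKernel y • (inner ℝ (F x) (F x - G (x + r • y)) : ℝ) with hd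
  have hdc : Continuous d := hw.smul (continuous_const.inner (continuous_const.sub hGc))
  have hdcs : HasCompactSupport d := hwc.smul_right
  -- With `‖b‖ ≤ ‖a‖`, expanding `‖a - b‖ ^ 2` bounds it by `2⟨a, a - b⟩`, so vanishing of the inner
  -- product forces `a = b`.
  have hinner {y : EuclideanSpace ℝ ι} (hy : ‖y‖ < 1) :
      ‖F x - F (x + r • y)‖ ^ 2 ≤ 2 * inner ℝ (F x) (F x - F (x + r • y)) := by
    have h1 : ‖F (x + r • y)‖ ≤ ‖F x‖ := (hb _ (ball_subset_ball hrR.le (hmem hy))).2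
    have h2 := norm_sub_sq_real (F x) (F (x + r • y))
    rw [inner_sub_right, real_inner_self_eq_norm_sq]
    nlinarith [norm_nonneg (F (x + r • y))]
  have hd0 : 0 ≤ d := by
    intro y
    rcases le_or_gt 1 ‖y‖ with hy | hy
    · simp [hd, radialKernel_eq_zero hy]
    · refine mul_nonneg (radialKernel_nonneg y) ?_
      rw [hGF' hy]
      nlinarith [hinner hy, sq_nonneg ‖F x - F (x + r • y)‖]
  have hint : ∫ y, d y = 0 := by
    have h1 : ∀ y, d y = inner ℝ (F x)
        (radialKernel y • F x - radialKernel y • F (x + r • y)) := by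
      intro y
      rcases le_or_gt 1 ‖y‖ with hy | hy
      · simp [hd, radialKernel_eq_zero hy]
      · simp only [hd]
        rw [← smul_sub, inner_smul_right, hGF' hy, smul_eq_mul]
    have h2 : (fun y : EuclideanSpace ℝ ι => radialKernel y • F (x + r • y))
        = fun y => radialKernel y • G (x + r • y) := by
      ext1 y
      rcases le_or_gt 1 ‖y‖ with hy | hy
      · simp [radialKernel_eq_zero hy]
      · rw [hGF' hy]
    have h3 : Integrable fun y : EuclideanSpace ℝ ι => radialKernel y • F (x + r • y) := by
      rw [h2]; exact integrable_smul_of_hasCompactSupport hw hwc hGc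
    have h4 : Integrable fun y : EuclideanSpace ℝ ι => radialKernel y • F x :=
      integrable_smul_of_hasCompactSupport hw hwc continuous_const
    simp_rw [h1]
    have h5 := integral_inner (𝕜 := ℝ) (h4.sub h3) (F x)
    simp only [Pi.sub_apply] at h5
    rw [h5, integral_sub h4 h3, hmvp, integral_smul_const, sub_self,
      inner_zero_right]
  intro z hz
  obtain ⟨y, hy, rfl⟩ : ∃ y : EuclideanSpace ℝ ι, ‖y‖ < 1 ∧ z = x + r • y := by
    refine ⟨r⁻¹ • (z - x), ?_, by rw [smul_inv_smul₀ hr0.ne']; abel⟩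
    rw [norm_smul, Real.norm_of_nonneg (by positivity), inv_mul_lt_iff₀ hr0, mul_one]
    simpa [dist_eq_norm] using hz
  have hdy : d y = 0 := by
    by_contra h
    exact (hdc.integral_pos_of_hasCompactSupport_nonneg_nonzero hdcs hd0 h).ne' hint
  have h := (smul_eq_zero.1 hdy).resolve_left (radialKernel_pos hy).ne'
  rw [hGF' hy] at h
  have h' := hinner hy
  rw [h, mul_zero] at h'
  have : ‖F x - F (x + r • y)‖ = 0 := by nlinarith [norm_nonneg (F x - F (x + r • y))]
  exact (sub_eq_zero.1 (norm_eq_zero.1 this)).symm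

end UniqueContinuation

/-! ### Propagation from a coordinate hyperplane. -/

section Monogenic

open MeasureTheory Metric Set Filter Topology

variable {ι : Type*} [Fintype ι] [DecidableEq ι]
  {V : Type*} [NormedAddCommGroup V] [InnerProductSpace ℝ V]
  {L L' : ι → V →L[ℝ] V} {F : EuclideanSpace ℝ ι → V} {U : Set (EuclideanSpace ℝ ι)}

lemma IsMonogenicOn.sub_const (hF : IsMonogenicOn L F U) (c : V) :
    IsMonogenicOn L (fun x => F x - c) U := by
  refine ⟨hF.contDiffOn.sub contDiffOn_const, fun x hx => ?_⟩
  have := hF.dirac_eq_zero x hx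
  simpa only [dirac, fderiv_sub_const] using this

/-- If a monogenic function vanishes on a coordinate hyperplane, so do its derivatives. -/
lemma IsMonogenicOn.dirDeriv_eq_zero_of_hyperplane (hL : IsCliffordPair L L') (hU : IsOpen U)
    (hF : IsMonogenicOn L F U) (n : ι) (h0 : ∀ x ∈ U, x n = 0 → F x = 0)
    (v : EuclideanSpace ℝ ι) : ∀ x ∈ U, x n = 0 → dirDeriv v F x = 0 := by
  intro x hx hxn
  have hd : DifferentiableAt ℝ F x :=
    (hF.contDiffOn.contDiffAt (hU.mem_nhds hx)).differentiableAt (by norm_num)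
  have htan (i : ι) (hi : i ≠ n) : fderiv ℝ F x (EuclideanSpace.single i 1) = 0 := by
    have h1 : HasDerivAt (fun s : ℝ => x + s • EuclideanSpace.single i (1 : ℝ))
        (EuclideanSpace.single i (1 : ℝ)) 0 := by
      simpa using ((hasDerivAt_id (0 : ℝ)).smul_const
        (EuclideanSpace.single i (1 : ℝ))).const_add x
    have h2 : HasFDerivAt F (fderiv ℝ F x) (x + (0 : ℝ) • EuclideanSpace.single i (1 : ℝ)) := by
      simpa using hd.hasFDerivAt
    have h3 := h2.comp_hasDerivAt 0 h1
    have h4 : (F ∘ fun s : ℝ => x + s • EuclideanSpace.single i (1 : ℝ)) =ᶠ[𝓝 0] fun _ => 0 := by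
      have : ∀ᶠ s : ℝ in 𝓝 0, x + s • EuclideanSpace.single i (1 : ℝ) ∈ U :=
        h1.continuousAt.eventually_mem (by simpa using hU.mem_nhds hx)
      filter_upwards [this] with s hs
      exact h0 _ hs (by simp [hxn, hi.symm])
    exact h3.unique ((hasDerivAt_const (0 : ℝ) (0 : V)).congr_of_eventuallyEq h4)
  -- The equation reduces to its normal term, and `Lₙ` is injective because `2 L'ₙ Lₙ = 2`.
  have hnor : fderiv ℝ F x (EuclideanSpace.single n 1) = 0 := by
    have h1 := hF.dirac_eq_zero x hx
    rw [dirac, Finset.sum_eq_single n (fun i _ hi => by rw [htan i hi, map_zero]) (by simp)] at h1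
    have h2 := hL n n (fderiv ℝ F x (EuclideanSpace.single n 1))
    rw [h1, map_zero, if_pos rfl, add_zero] at h2
    exact (smul_eq_zero.1 h2.symm).resolve_left two_ne_zero
  rw [dirDeriv, ContinuousLinearMap.apply_eq_sum_single]
  refine Finset.sum_eq_zero fun i _ => ?_
  rcases eq_or_ne i n with rfl | hi
  · rw [hnor, smul_zero]
  · rw [htan i hi, smul_zero]

lemma IsMonogenicOn.iterate_dirDeriv_eq_zero_of_hyperplane [CompleteSpace V]
    (hL : IsCliffordPair L L') (hU : IsOpen U) (n : ι) (v : EuclideanSpace ℝ ι) (k : ℕ)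
    (hF : IsMonogenicOn L F U) (h0 : ∀ x ∈ U, x n = 0 → F x = 0) :
    ∀ x ∈ U, x n = 0 → (dirDeriv v)^[k] F x = 0 := by
  induction k generalizing F with
  | zero => exact h0
  | succ k ih =>
    exact ih (hF.fderiv_apply hL hU v) (hF.dirDeriv_eq_zero_of_hyperplane hL hU n h0 v)

end Monogenic

/-! ### Octonion multiplication and its Clifford relations. -/

namespace Octonion

open MeasureTheory Metric Set Filter Topology

lemma mul_apply (x y : Octonion) (k : Fin 8) :
    (x * y) k = ∑ i : Fin 8, ∑ j : Fin 8, (structureConst i j k : ℝ) * (x i * y j) := rfl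

/-- The eight coordinate formulas reduce the polarised alternative law to polynomial identities. -/
lemma mul_apply_zero (x y : Octonion) : (x * y) 0 =
    x 0 * y 0 - x 1 * y 1 - x 2 * y 2 - x 3 * y 3
    - x 4 * y 4 - x 5 * y 5 - x 6 * y 6 - x 7 * y 7 := by
  simp [mul_apply, Fin.sum_univ_eight, structureConst, eps, triples]
  ring

lemma mul_apply_one (x y : Octonion) : (x * y) 1 =
    x 0 * y 1 + x 1 * y 0 + x 2 * y 3 - x 3 * y 2
    + x 4 * y 5 - x 5 * y 4 - x 6 * y 7 + x 7 * y 6 := by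
  simp [mul_apply, Fin.sum_univ_eight, structureConst, eps, triples]
  ring

lemma mul_apply_two (x y : Octonion) : (x * y) 2 =
    x 0 * y 2 - x 1 * y 3 + x 2 * y 0 + x 3 * y 1
    + x 4 * y 6 + x 5 * y 7 - x 6 * y 4 - x 7 * y 5 := by
  simp [mul_apply, Fin.sum_univ_eight, structureConst, eps, triples]
  ring

lemma mul_apply_three (x y : Octonion) : (x * y) 3 =
    x 0 * y 3 + x 1 * y 2 - x 2 * y 1 + x 3 * y 0
    + x 4 * y 7 - x 5 * y 6 + x 6 * y 5 - x 7 * y 4 := by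
  simp [mul_apply, Fin.sum_univ_eight, structureConst, eps, triples]
  ring

lemma mul_apply_four (x y : Octonion) : (x * y) 4 =
    x 0 * y 4 - x 1 * y 5 - x 2 * y 6 - x 3 * y 7
    + x 4 * y 0 + x 5 * y 1 + x 6 * y 2 + x 7 * y 3 := by
  simp [mul_apply, Fin.sum_univ_eight, structureConst, eps, triples]
  ring

lemma mul_apply_five (x y : Octonion) : (x * y) 5 =
    x 0 * y 5 + x 1 * y 4 - x 2 * y 7 + x 3 * y 6
    - x 4 * y 1 + x 5 * y 0 - x 6 * y 3 + x 7 * y 2 := by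
  simp [mul_apply, Fin.sum_univ_eight, structureConst, eps, triples]
  ring

lemma mul_apply_six (x y : Octonion) : (x * y) 6 =
    x 0 * y 6 + x 1 * y 7 + x 2 * y 4 - x 3 * y 5
    - x 4 * y 2 + x 5 * y 3 + x 6 * y 0 - x 7 * y 1 := by
  simp [mul_apply, Fin.sum_univ_eight, structureConst, eps, triples]
  ring

lemma mul_apply_seven (x y : Octonion) : (x * y) 7 =
    x 0 * y 7 - x 1 * y 6 + x 2 * y 5 + x 3 * y 4
    - x 4 * y 3 - x 5 * y 2 + x 6 * y 1 + x 7 * y 0 := by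
  simp [mul_apply, Fin.sum_univ_eight, structureConst, eps, triples]
  ring

/-- Octonionic conjugation. -/
noncomputable def octConj (x : Octonion) : Octonion :=
  WithLp.toLp 2 fun i => if i = 0 then x i else -x i

/-- The polarised left alternative law. -/
lemma octConj_mul_mul_add (a b x : Octonion) :
    octConj a * (b * x) + octConj b * (a * x) = (2 * inner ℝ a b : ℝ) • x := by
  ext k
  fin_cases k <;>
  · simp [mul_apply_zero, mul_apply_one, mul_apply_two, mul_apply_three, mul_apply_four,
      mul_apply_five, mul_apply_six, mul_apply_seven, octConj, PiLp.inner_apply,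
      Fin.sum_univ_eight]
    ring

/-- Left multiplication as a continuous linear map. -/
noncomputable def mulLeft (a : Octonion) : Octonion →L[ℝ] Octonion :=
  LinearMap.toContinuousLinearMap
    { toFun := fun x => a * x
      map_add' := fun x y => by
        ext k
        simp [mul_apply, mul_add, Finset.sum_add_distrib]
      map_smul' := fun c x => by
        ext k
        simp only [mul_apply, PiLp.smul_apply, smul_eq_mul, RingHom.id_apply, Finset.mul_sum]
        exact Finset.sum_congr rfl fun i _ => Finset.sum_congr rfl fun j _ => by ring }

@[simp] lemma mulLeft_apply (a x : Octonion) : mulLeft a x = a * x := rfl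

lemma isCliffordPair_mulLeft {ι : Type*} [DecidableEq ι] {b : ι → Octonion}
    (hb : Orthonormal ℝ b) :
    IsCliffordPair (fun i => mulLeft (b i)) (fun i => mulLeft (octConj (b i))) := by
  intro i j x
  simp only [mulLeft_apply, octConj_mul_mul_add, orthonormal_iff_ite.1 hb i j]
  split_ifs <;> simp

/-! ### Slices and the passage from one slice to another. -/

/-- The orthonormal system `e_0, …, e_p, ω`. -/
noncomputable def sliceBasis (p : Fin 7) (ω : Octonion) : Fin ((p : ℕ) + 2) → Octonion :=
  Fin.snoc (α := fun _ => Octonion) (fun i : Fin ((p : ℕ) + 1) => e (idx p i)) ω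

@[simp] lemma sliceBasis_castSucc (p : Fin 7) (ω : Octonion) (i : Fin ((p : ℕ) + 1)) :
    sliceBasis p ω i.castSucc = e (idx p i) := by
  simp [sliceBasis]

@[simp] lemma sliceBasis_last (p : Fin 7) (ω : Octonion) :
    sliceBasis p ω (Fin.last _) = ω := by
  simp [sliceBasis]

lemma idx_injective (p : Fin 7) : Function.Injective (idx p) := Fin.castLE_injective (by omega)

lemma idx_le (p : Fin 7) (i : Fin ((p : ℕ) + 1)) : (idx p i : ℕ) ≤ p :=
  Nat.lt_succ_iff.1 i.2

lemma orthonormal_sliceBasis {p : Fin 7} {ω : Octonion} (hω : ω ∈ sphere p) :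
    Orthonormal ℝ (sliceBasis p ω) := by
  rw [orthonormal_iff_ite]
  intro i j
  refine Fin.lastCases ?_ (fun i => ?_) i <;> refine Fin.lastCases ?_ (fun j => ?_) j
  · simp [hω.2]
  · simp [e, EuclideanSpace.inner_single_right, hω.1 _ (idx_le p j), (Fin.castSucc_ne_last j).symm]
  · simp [e, EuclideanSpace.inner_single_left, hω.1 _ (idx_le p i), Fin.castSucc_ne_last i]
  · simp [e, EuclideanSpace.inner_single_left, (idx_injective p).eq_iff]

lemma isMonogenicOn_restrict {p : Fin 7} {Ω : Set Octonion} {f : Octonion → Octonion}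
    (hf : IsGSM p Ω f) {ω : Octonion} (hω : ω ∈ sphere p) :
    IsMonogenicOn (fun i => mulLeft (sliceBasis p ω i)) (restrict p ω f) (slice p ω Ω) := by
  refine ⟨(hf ω hω).1, fun v hv => ?_⟩
  rw [dirac, Fin.sum_univ_castSucc]
  simpa [sliceD] using (hf ω hω).2 v hv

lemma continuous_slicePoint (p : Fin 7) (ω : Octonion) : Continuous (slicePoint p ω) := by
  unfold slicePoint
  fun_prop

lemma sum_smul_e_apply (p : Fin 7) (c : Fin ((p : ℕ) + 1) → ℝ) (k : Fin 8) :
    (∑ i, c i • e (idx p i)) k = if h : (k : ℕ) < (p : ℕ) + 1 then c ⟨k, h⟩ else 0 := by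
  have hterm (i) : (c i • e (idx p i)) k = if (k : ℕ) = i then c i else 0 := by
    simp [e, Fin.ext_iff, idx]
  simp only [WithLp.ofLp_sum, Finset.sum_apply, hterm]
  split_ifs with h
  · rw [Finset.sum_eq_single ⟨k, h⟩ (fun i _ hi => if_neg fun hk => hi (Fin.ext hk.symm))
      (by simp)]
    simp
  · exact Finset.sum_eq_zero fun i _ => if_neg fun hk => h (by rw [hk]; exact i.2)

lemma e_last_mem_sphere (p : Fin 7) : e 7 ∈ sphere p := by
  refine ⟨fun i hi => ?_, by simp [e]⟩
  have : i ≠ 7 := by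
    rintro rfl
    have := p.2
    simp at hi
    omega
  simp [e, this]

/-- The coordinates in a slice of the paravector part of `x` together with a last coordinate. -/
noncomputable def sliceCoords (p : Fin 7) (x : Octonion) (r : ℝ) :
    EuclideanSpace ℝ (Fin ((p : ℕ) + 2)) :=
  WithLp.toLp 2 (Fin.snoc (α := fun _ => ℝ) (fun i : Fin ((p : ℕ) + 1) => x (idx p i)) r)

lemma slicePoint_sliceCoords (p : Fin 7) (ω x : Octonion) (r : ℝ) (k : Fin 8) :
    slicePoint p ω (sliceCoords p x r) k = (if (k : ℕ) ≤ p then x k else 0) + r * ω k := by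
  simp only [slicePoint, PiLp.add_apply, sum_smul_e_apply]
  have hcoord (i : Fin ((p : ℕ) + 1)) : sliceCoords p x r i.castSucc = x (idx p i) := by
    simp [sliceCoords]
  have hlast : sliceCoords p x r (Fin.last _) = r := by simp [sliceCoords]
  simp only [hcoord, hlast, PiLp.smul_apply, smul_eq_mul]
  congr 1
  by_cases hk : (k : ℕ) ≤ p
  · rw [dif_pos (Nat.lt_succ_of_le hk), if_pos hk]
    rfl
  · rw [dif_neg (by omega), if_neg hk]

lemma exists_slicePoint_eq (p : Fin 7) (x : Octonion) :
    ∃ ω ∈ sphere p, ∃ v, slicePoint p ω v = x := by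
  set y : Octonion := WithLp.toLp 2 fun k : Fin 8 => if (k : ℕ) ≤ p then 0 else x k with hy
  rcases eq_or_ne y 0 with h0 | h0
  · refine ⟨e 7, e_last_mem_sphere p, sliceCoords p x 0, ?_⟩
    ext k
    have : y k = 0 := by rw [h0]; rfl
    simp only [hy] at this
    rw [slicePoint_sliceCoords]
    split_ifs at this ⊢ <;> simp [this]
  · refine ⟨‖y‖⁻¹ • y, ⟨fun i hi => by simp [hy, hi], ?_⟩, sliceCoords p x ‖y‖, ?_⟩
    · rw [norm_smul, norm_inv, norm_norm, inv_mul_cancel₀ (norm_ne_zero_iff.2 h0)]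
    · ext k
      rw [slicePoint_sliceCoords, PiLp.smul_apply, smul_eq_mul,
        mul_inv_cancel_left₀ (norm_ne_zero_iff.2 h0)]
      by_cases hk : (k : ℕ) ≤ p <;> simp [hy, hk]

lemma slicePoint_sliceCoords_of_mem_paravectors {p : Fin 7} {x : Octonion}
    (hx : x ∈ paravectors p) (ω : Octonion) : slicePoint p ω (sliceCoords p x 0) = x := by
  ext k
  rw [slicePoint_sliceCoords]
  split_ifs with hk
  · simp
  · simp [hx k (not_le.1 hk)]

lemma slicePoint_of_last_eq_zero {p : Fin 7} {v : EuclideanSpace ℝ (Fin ((p : ℕ) + 2))}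
    (hv : v (Fin.last _) = 0) (ω ω' : Octonion) : slicePoint p ω v = slicePoint p ω' v := by
  simp [slicePoint, hv]

/-- On the slice through a local maximum of `|f|`, the function `f` is constant. -/
lemma restrict_eq_const_of_isLocalMaxOn {p : Fin 7} {Ω : Set Octonion} {f : Octonion → Octonion}
    (hΩ : IsSliceDomain p Ω) (hf : IsGSM p Ω f) {ω : Octonion} (hω : ω ∈ sphere p)
    {v : EuclideanSpace ℝ (Fin ((p : ℕ) + 2))} (hv : v ∈ slice p ω Ω)
    (hmax : IsLocalMaxOn (fun x => ‖f x‖) Ω (slicePoint p ω v)) :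
    ∀ w ∈ slice p ω Ω, restrict p ω f w = restrict p ω f v := by
  have hL := isCliffordPair_mulLeft (orthonormal_sliceBasis hω)
  have hU := hΩ.slice_isOpen ω hω
  have hF := isMonogenicOn_restrict hf hω
  -- Only continuity of `slicePoint` is needed to pull the maximum back; `f` itself is known to be
  -- regular only along slices.
  have hmax' : IsLocalMax (fun w => ‖restrict p ω f w‖) v :=
    (continuous_slicePoint p ω).continuousAt.eventually (hmax.isLocalMax (hΩ.isOpen.mem_nhds hv))
  obtain ⟨ε, hε, -, hc⟩ := hF.eventually_eq_of_isLocalMax_norm hL hU hv hmax'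
  intro w hw
  refine sub_eq_zero.1 ((hF.sub_const (restrict p ω f v)).eq_zero_of_isPreconnected hL hU
    (hΩ.slice_isConnected ω hω).isPreconnected hv (fun u k => ?_) w hw)
  exact iterate_dirDeriv_eqOn_zero isOpen_ball u k (fun y hy => sub_eq_zero.2 (hc y hy)) v
    (mem_ball_self hε)

/-- Two slices share the paravectors, so a constant value propagates from one to the other. -/
lemma restrict_eq_const_of_restrict_eq_const {p : Fin 7} {Ω : Set Octonion}
    {f : Octonion → Octonion} (hΩ : IsSliceDomain p Ω) (hf : IsGSM p Ω f) {ω ω' c : Octonion}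
    (hω' : ω' ∈ sphere p) (hc : ∀ v ∈ slice p ω Ω, restrict p ω f v = c) :
    ∀ v ∈ slice p ω' Ω, restrict p ω' f v = c := by
  have hL := isCliffordPair_mulLeft (orthonormal_sliceBasis hω')
  have hU := hΩ.slice_isOpen ω' hω'
  have hF := (isMonogenicOn_restrict hf hω').sub_const c
  obtain ⟨b, hbΩ, hbp⟩ := hΩ.inter_nonempty
  have hb : sliceCoords p b 0 ∈ slice p ω' Ω := by
    rw [slice, mem_ofPred_eq, slicePoint_sliceCoords_of_mem_paravectors hbp]
    exact hbΩ
  -- Where the last coordinate vanishes, both slices parametrise the same point of `Ω`.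
  have h0 : ∀ v ∈ slice p ω' Ω, v (Fin.last _) = 0 → restrict p ω' f v - c = 0 := by
    intro v hv hv0
    have h1 := slicePoint_of_last_eq_zero hv0 ω' ω
    rw [slice, mem_ofPred_eq, h1] at hv
    rw [restrict, h1, sub_eq_zero]
    exact hc v hv
  intro v hv
  refine sub_eq_zero.1 (hF.eq_zero_of_isPreconnected hL hU
    (hΩ.slice_isConnected ω' hω').isPreconnected hb (fun u k => ?_) v hv)
  exact hF.iterate_dirDeriv_eq_zero_of_hyperplane hL hU (Fin.last _) u k h0 _ hb
    (by simp [sliceCoords])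

end Octonion

theorem mainTheorem8 (p : Fin 7) (Ω : Set Octonion) (f : Octonion → Octonion)
    (hΩ : Octonion.IsSliceDomain p Ω) (hf : Octonion.IsGSM p Ω f)
    (hmax : ∃ a ∈ Ω, IsLocalMaxOn (fun x => ‖f x‖) Ω a) :
    ∃ c : Octonion, ∀ x ∈ Ω, f x = c := by
  obtain ⟨a, ha, hmax⟩ := hmax
  obtain ⟨ω, hω, v, rfl⟩ := Octonion.exists_slicePoint_eq p a
  refine ⟨f (Octonion.slicePoint p ω v), fun x hx => ?_⟩
  obtain ⟨ω', hω', v', rfl⟩ := Octonion.exists_slicePoint_eq p x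
  exact Octonion.restrict_eq_const_of_restrict_eq_const hΩ hf hω'
    (Octonion.restrict_eq_const_of_isLocalMaxOn hΩ hf hω ha hmax) v' hx
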